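/- **Conventions.** Let $\mathbf{x}=(x_i)_{i\in I}$ be a (possibly empty) family of indeterminates. An infinite matrix $[m_{n,k}]_{n,k\ge 0}$ over $\mathbb{R}$ (resp. over $\mathbb{R}[\mathbf{x}]$) is TP$_r$ (resp. $\mathbf{x}$-TP$_r$) if all its minors of order at most $r$ are nonnegative (resp. are polynomials with nonnegative coefficients), and it is TP (resp. $\mathbf{x}$-TP) if this holds for every $r$. A series $\varphi(t)=\sum_{n\ge0}\varphi_nt^n\in\mathbb{R}[[t]]$ is PF$_r$ (resp. PF) if the Toeplitz matrix $[\varphi_{i-j}]_{i,j\ge0}$, where $\varphi_n=0$ for $n<0$, is TP$_r$ (resp. TP). Let $K$ be a field of characteristic $0$. An exponential Riordan array over $K$ is a lower-triangular matrix $$R_{n,k}=\frac{n!}{k!}\,[t^n]\,g(t)f(t)^k,\qquad n,k\ge0,$$ where $g,f\in K[[t]]$, $g(0)=1$ (that is, $R_{0,0}=1$), $f(0)=0$ and $f'(0)\ne0$. If $\bar f$ is the compositional inverse of $f$, its associated series are $Z(t)=g'(\bar f(t))/g(\bar f(t))$ and $A(t)=f'(\bar f(t))$. **Theorem.** Let $[R_{n,k}]_{n,k\ge0}$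 be an exponential Riordan array with $$Z(t)=(\nu+\omega t)\varphi(t),\qquad A(t)=(a+bt+ct^2)\varphi(t).$$ (i) Let $r\ge 0$, let $\varphi\in\mathbb{R}[[t]]$ be PF$_r$, and let $a,b,c,\nu,\omega\in\mathbb{R}[\mathbf{x}]$, with $R$ an array over the field of fractions of $\mathbb{R}[\mathbf{x}]$. If the tridiagonal matrix $$J=\begin{bmatrix}\nu&a&&&\\ \omega&\nu+b&2a&&\\ &\omega+c&\nu+2b&3a&\\ &&\omega+2c&\nu+3b&\ddots\\ &&&\ddots&\ddots\end{bmatrix}$$ is $\mathbf{x}$-TP$_r$, then all $R_{n,k}$ lie in $\mathbb{R}[\mathbf{x}]$, and both the triangle $[R_{n,k}]_{n,k\ge0}$ and the Hankel matrix $[R_{i+j,0}]_{i,j\ge0}$ are $\mathbf{x}$-TP$_r$. (ii) Let $\varphi\in\mathbb{R}[[t]]$ and let $R$ be an array over $\mathbb{R}$ with $\nu,\omega,a,b,c\in\mathbb{R}^{\ge0}$, $\nu\ge\omega$ and $b\ge a+c$. If $\varphi$ is PF, then $[R_{n,k}]_{n,k\ge0}$ and $[R_{i+j,0}]_{i,j\ge0}$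 are TP. More precisely, for every $r$, if $\varphi$ is PF$_r$, then both matrices are TP$_r$. (iii) The conclusion of (ii) also holds if $\nu,\omega,a,b,c\in\mathbb{R}^{\ge0}$, $\nu\ge a$ and $b\ge\max\{a+c,\,a+\omega\}$. (iv) Let $\varphi\in\mathbb{R}[[t]]$ be PF and $\omega=c=0$. If $a,b,\nu$ are three of the indeterminates $\mathbf x$ or, more generally, polynomials in $\mathbb{R}[\mathbf{x}]$ with nonnegative coefficients, with $R$ an array over the field of fractions of $\mathbb{R}[\mathbf{x}]$, then all $R_{n,k}$ lie in $\mathbb{R}[\mathbf{x}]$, and $[R_{n,k}]_{n,k\ge0}$ and $[R_{i+j,0}]_{i,j\ge0}$ are $\mathbf{x}$-TP. In particular, they are $(a,b,\nu)$-TP when $a,b,\nu$ are indeterminates. (v) Let $F$ be any field of characteristic $0$, $m\ge0$ and $x_1,\dots,x_m,\nu,b\in F$ (for instance, real numbers, or indeterminates in a field of rational functions). Let $\varphi(t)=\prod_{i=1}^m(1+x_it)$, $\omega=c=0$ and $a=1$, with $R$ an array over $F$. Then there is the $m$-branched Stieltjes-type continued fraction $$\sum_{n\ge0}R_{n,0}t^n=\cfrac{1}{1-\alpha_mt\prod\limits_{i_1=1}^m\cfrac{1}{1-\alpha_{m+i_1}t\prod\limits_{i_2=1}^m\cfrac{1}{1-\alpha_{m+i_1+i_2}t\prod\limits_{i_3=1}^m\cfrac{1}{1-\cdots}}}}$$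 (the coefficientwise limit in $F[[t]]$ of its finite truncations), with coefficients $$(\alpha_i)_{i\ge m}=(\nu,\ x_1,\dots,x_m,\ \nu+b,\ 2x_1,\dots,2x_m,\ \nu+2b,\ 3x_1,\dots,3x_m,\ \dots).$$ -/

import Mathlib

open Filter

noncomputable section

/-! ### Total positivity -/

/-- Every minor of order `k ≤ r` of the infinite matrix `M` lies in the set `P`. -/
def MinorsIn {S : Type*} [CommRing S] (P : Set S) (r : ℕ) (M : Matrix ℕ ℕ S) : Prop :=
  ∀ k ≤ r, ∀ rows cols : Fin k → ℕ, StrictMono rows → StrictMono cols →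
    (M.submatrix rows cols).det ∈ P

/-- `TP_r` for real matrices. -/
def IsTPr (r : ℕ) (M : Matrix ℕ ℕ ℝ) : Prop :=
  MinorsIn {y : ℝ | 0 ≤ y} r M

/-- `TP` for real matrices. -/
def IsTP (M : Matrix ℕ ℕ ℝ) : Prop := ∀ r, IsTPr r M

/-- The polynomial `p` has only nonnegative coefficients. -/
def NonnegCoeffs {σ : Type*} (p : MvPolynomial σ ℝ) : Prop :=
  ∀ d : σ →₀ ℕ, 0 ≤ MvPolynomial.coeff d p

/-- Coefficientwise `TP_r` (that is, `x-TP_r`) for matrices over `ℝ[x]`,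
where `x = (x_i)_{i ∈ σ}`. -/
def IsCoeffTPr {σ : Type*} (r : ℕ) (M : Matrix ℕ ℕ (MvPolynomial σ ℝ)) : Prop :=
  MinorsIn {p : MvPolynomial σ ℝ | NonnegCoeffs p} r M

/-- Coefficientwise `TP` (that is, `x-TP`) for matrices over `ℝ[x]`. -/
def IsCoeffTP {σ : Type*} (M : Matrix ℕ ℕ (MvPolynomial σ ℝ)) : Prop :=
  ∀ r, IsCoeffTPr r M

/-- The Hankel matrix `[u_{i+j}]`. -/
def hankelMat {S : Type*} (u : ℕ → S) : Matrix ℕ ℕ S :=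
  Matrix.of fun i j => u (i + j)

/-- The lower triangular Toeplitz matrix `[φ_{i-j}]` of the coefficients of a power series. -/
def toeplitzMat (φ : PowerSeries ℝ) : Matrix ℕ ℕ ℝ :=
  Matrix.of fun i j => if j ≤ i then PowerSeries.coeff (i - j) φ else 0

/-- `PF_r` functions. -/
def IsPFr (r : ℕ) (φ : PowerSeries ℝ) : Prop := IsTPr r (toeplitzMat φ)

/-- `PF` functions. -/
def IsPF (φ : PowerSeries ℝ) : Prop := IsTP (toeplitzMat φ)

/-! ### Exponential Riordan arrays -/

/-- The matrix with entries `(n! / k!) [t^n] g(t) f(t)^k`. -/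
def expRiordan {K : Type*} [Field K] (g f : PowerSeries K) : Matrix ℕ ℕ K :=
  Matrix.of fun n k =>
    ((n.factorial : K) / (k.factorial : K)) * PowerSeries.coeff n (g * f ^ k)

/-- `R` is the exponential Riordan array `(g, f)` of some `g`, `f` with `g(0) = 1`, `f(0) = 0`,
`f'(0) ≠ 0`, whose associated series are `Z = g'(fbar) / g(fbar)` and `A = f'(fbar)`,
where `fbar` is the compositional inverse of `f`. -/
def IsExpRiordanArray {K : Type*} [Field K] (R : Matrix ℕ ℕ K) (Z A : PowerSeries K) : Prop :=
  ∃ g f fbar : PowerSeries K,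
    PowerSeries.constantCoeff g = 1 ∧
    PowerSeries.constantCoeff f = 0 ∧
    PowerSeries.coeff 1 f ≠ 0 ∧
    PowerSeries.constantCoeff fbar = 0 ∧
    PowerSeries.subst fbar f = (PowerSeries.X : PowerSeries K) ∧
    PowerSeries.subst f fbar = (PowerSeries.X : PowerSeries K) ∧
    Z = (PowerSeries.subst fbar (PowerSeries.derivative K g) : PowerSeries K) *
      (PowerSeries.subst fbar g : PowerSeries K)⁻¹ ∧
    A = PowerSeries.subst fbar (PowerSeries.derivative K f) ∧
    R = expRiordan g f

/-- `Z(t) = (ν + ω t) φ(t)`. -/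
def zSeries {S : Type*} [CommRing S] (ν ω : S) (φ : PowerSeries S) : PowerSeries S :=
  (PowerSeries.C ν + PowerSeries.C ω * PowerSeries.X) * φ

/-- `A(t) = (a + b t + c t^2) φ(t)`. -/
def aSeries {S : Type*} [CommRing S] (a b c : S) (φ : PowerSeries S) : PowerSeries S :=
  (PowerSeries.C a + PowerSeries.C b * PowerSeries.X + PowerSeries.C c * PowerSeries.X ^ 2) * φ

/-- The tridiagonal matrix with diagonal entries `ν + n b`, superdiagonal entries `(n + 1) a`
and subdiagonal entries `ω + n c`, for `n = 0, 1, 2, …`. -/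
def tridiagJ {S : Type*} [CommRing S] (ν ω a b c : S) : Matrix ℕ ℕ S :=
  Matrix.of fun i j =>
    if j = i + 1 then ((i : S) + 1) * a
    else if j = i then ν + (i : S) * b
    else if i = j + 1 then ω + (j : S) * c
    else 0

/-! ### Branched continued fractions -/

/-- Truncation after `d` levels of the `m`-branched Stieltjes-type continued fraction with
coefficients `(α_i)_{i ≥ m}`, started at position `k`:
`T_0(k) = 1` and `T_{d+1}(k) = 1 / (1 - α_{m+k} t ∏_{i=1}^m T_d(k+i))`. The whole fraction
is started at `k = 0`. -/
def branchedSTrunc {K : Type*} [Field K] (m : ℕ) (α : ℕ → K) : ℕ → ℕ → PowerSeries K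
  | 0, _ => 1
  | d + 1, k =>
      (1 - PowerSeries.C (α (m + k)) * PowerSeries.X *
        ∏ i : Fin m, branchedSTrunc m α d (k + ((i : ℕ) + 1)))⁻¹

/-- The formal power series `F` is the value of the `m`-branched Stieltjes-type continued fraction
with coefficients `(α_i)_{i ≥ m}`: each coefficient of `F` is the eventually constant value of
the corresponding coefficient of the truncations. -/
def IsBranchedSFraction {K : Type*} [Field K] (m : ℕ) (α : ℕ → K) (F : PowerSeries K) : Prop :=
  ∀ n, ∀ᶠ d in atTop, PowerSeries.coeff n (branchedSTrunc m α d 0) = PowerSeries.coeff n F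

end

/-!
Up to a rescaling of its columns by factorials, an exponential Riordan array is generated row by
row by its production matrix `Q`: row `n + 1` is row `n` times `Q`, and row `0` is `e₀`. When
`Z = (ν + ω t) φ` and `A = (a + b t + c t²) φ`, this `Q` factors as the Toeplitz matrix of `φ` times
the tridiagonal matrix `J`, so by the Cauchy–Binet formula its minors of order at most `r` are
nonnegative when those of both factors are. The property passes from `Q` to the matrix with rows
`e₀ Qⁿ`, transposing, to the one with columns `Qⁿ e₀ᵀ`, and hence to their product, which is the
Hankel matrix of the entries `e₀ Qⁿ e₀ᵀ`. The matrix `J` itself is bidiagonal in part (iv); in parts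
(ii) and (iii) a column or row dominance condition keeps the pivots of Gaussian elimination
nonnegative, so that `J` is a product of nonnegative bidiagonal matrices.

For part (v), let `u p` be the series `∑ n! [tⁿ] (g p(f)) tⁿ` attached to a polynomial `p`. The
differential equations of `g` and `f` give `u p = p(0) + t u(φ (ν p + (1 + b t) p'))`, which
determines `u` coefficient by coefficient. The products of consecutive tails of the continued
fraction solve the same equation: the recurrence `P_{k+1} = P_k + α_{m+k} t P_{k+m+1}` absorbs the
linear factors of `φ` one at a time.
-/

/-! ### The Cauchy–Binet formula -/

section CauchyBinet

variable {S ι : Type*} [CommRing S] {k : ℕ}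

lemma det_mul_eq_sum_prod_mul_det [Fintype ι]
    (A : Matrix (Fin k) ι S) (B : Matrix ι (Fin k) S) :
    (A * B).det = ∑ p : Fin k → ι, (∏ i, A i (p i)) * (B.submatrix p id).det := by
  have hrow : A * B = fun i => ∑ l, A i l • B l := by
    ext i j
    simp [Matrix.mul_apply]
  calc (A * B).det
      = Matrix.detRowAlternating.toMultilinearMap fun i => ∑ l, A i l • B l := by rw [hrow]; rfl
    _ = ∑ p : Fin k → ι,
          Matrix.detRowAlternating.toMultilinearMap fun i => A i (p i) • B (p i) :=
        MultilinearMap.map_sum _ _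
    _ = ∑ p : Fin k → ι, (∏ i, A i (p i)) * (B.submatrix p id).det :=
        Finset.sum_congr rfl fun _ _ => MultilinearMap.map_smul_univ _ _ _

variable [LinearOrder ι]

lemma injective_orderEmbedding_comp_perm :
    Function.Injective fun x : (Fin k ↪o ι) × Equiv.Perm (Fin k) => x.1 ∘ x.2 := by
  rintro ⟨s, τ⟩ ⟨s', τ'⟩ h
  have hrange : Set.range s = Set.range s' := by
    simpa [Set.range_comp] using congrArg Set.range h
  obtain rfl : s = s' :=
    DFunLike.coe_injective ((s.strictMono.range_inj s'.strictMono).mp hrange)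
  obtain rfl : τ = τ' := Equiv.ext fun i => s.injective (congrFun h i)
  rfl

lemma exists_orderEmbedding_comp_perm_eq {p : Fin k → ι} (hp : Function.Injective p) :
    ∃ (s : Fin k ↪o ι) (τ : Equiv.Perm (Fin k)), s ∘ τ = p := by
  have hsort : StrictMono (p ∘ Tuple.sort p) :=
    (Tuple.monotone_sort p).strictMono_of_injective (hp.comp (Tuple.sort p).injective)
  refine ⟨OrderEmbedding.ofStrictMono _ hsort, (Tuple.sort p)⁻¹, ?_⟩
  ext i
  simp

theorem det_mul_cauchyBinet [Fintype ι] (A : Matrix (Fin k) ι S) (B : Matrix ι (Fin k) S) :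
    (A * B).det = ∑ s : Fin k ↪o ι, (A.submatrix id s).det * (B.submatrix s id).det := by
  have hsign (s : Fin k ↪o ι) (τ : Equiv.Perm (Fin k)) :
      (B.submatrix (s ∘ τ) id).det = Equiv.Perm.sign τ * (B.submatrix s id).det :=
    Matrix.det_permute τ (B.submatrix s id)
  calc (A * B).det
      = ∑ p : Fin k → ι, (∏ i, A i (p i)) * (B.submatrix p id).det :=
        det_mul_eq_sum_prod_mul_det A B
    _ = ∑ x : (Fin k ↪o ι) × Equiv.Perm (Fin k),
          (∏ i, A i (x.1 (x.2 i))) * (B.submatrix (x.1 ∘ x.2) id).det := by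
        refine (Fintype.sum_of_injective _ injective_orderEmbedding_comp_perm _ _ ?_ ?_).symm
        · intro p hp
          have hninj : ¬ Function.Injective p := fun hinj =>
            have ⟨s, τ, h⟩ := exists_orderEmbedding_comp_perm_eq hinj
            hp ⟨(s, τ), h⟩
          obtain ⟨i, j, hij, hne⟩ := Function.not_injective_iff.mp hninj
          rw [Matrix.det_zero_of_row_eq hne (by ext; simp [hij]), mul_zero]
        · exact fun _ => rfl
    _ = ∑ s : Fin k ↪o ι, (A.submatrix id s).det * (B.submatrix s id).det := by
        rw [Fintype.sum_prod_type]
        refine Finset.sum_congr rfl fun s _ => ?_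
        rw [← Matrix.det_transpose, Matrix.det_apply', Finset.sum_mul]
        refine Finset.sum_congr rfl fun τ _ => ?_
        simp only [hsign, Matrix.transpose_apply, Matrix.submatrix_apply, id_eq]
        ring

end CauchyBinet

lemma det_eq_mul_det_succ_of_row_zero {S : Type*} [CommRing S] {k : ℕ}
    {A : Matrix (Fin (k + 1)) (Fin (k + 1)) S} (hA : ∀ j : Fin k, A 0 j.succ = 0) :
    A.det = A 0 0 * (A.submatrix Fin.succ Fin.succ).det := by
  simp [Matrix.det_succ_row_zero, Fin.sum_univ_succ, hA]

lemma det_eq_mul_det_succ_of_column_zero {S : Type*} [CommRing S] {k : ℕ}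
    {A : Matrix (Fin (k + 1)) (Fin (k + 1)) S} (hA : ∀ i : Fin k, A i.succ 0 = 0) :
    A.det = A 0 0 * (A.submatrix Fin.succ Fin.succ).det := by
  simp [Matrix.det_succ_column_zero, Fin.sum_univ_succ, hA]

/-! ### Minors of infinite matrices -/

section Minors

variable {S : Type*} [CommRing S]

/-- `C` is the product of the infinite matrices `A` and `B`, all of whose entries are finite sums
`∑ l, A i l * B l j`. Mathlib's matrix product requires a finite middle index. -/
def IsLocallyFiniteMul (A B C : Matrix ℕ ℕ S) : Prop :=
  ∀ i j, ∀ᶠ N in atTop, C i j = ∑ l ∈ Finset.range N, A i l * B l j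

variable {A B C : Matrix ℕ ℕ S}

lemma IsLocallyFiniteMul.transpose (h : IsLocallyFiniteMul A B C) :
    IsLocallyFiniteMul B.transpose A.transpose C.transpose := fun i j => by
  simpa only [Matrix.transpose_apply, mul_comm] using h j i

lemma isLocallyFiniteMul_of_lowerTriangular (hA : ∀ i l, i < l → A i l = 0)
    (h : ∀ i j, C i j = ∑ l ∈ Finset.range (i + 1), A i l * B l j) :
    IsLocallyFiniteMul A B C := fun i j => by
  filter_upwards [eventually_ge_atTop (i + 1)] with N hN
  rw [h, Finset.eventually_constant_sum (fun l hl => by rw [hA i l hl, zero_mul]) hN]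

lemma IsLocallyFiniteMul.exists_submatrix_eq_mul (h : IsLocallyFiniteMul A B C) {k : ℕ}
    (rows cols : Fin k → ℕ) :
    ∃ N : ℕ, C.submatrix rows cols =
      A.submatrix rows (Fin.val : Fin N → ℕ) * B.submatrix (Fin.val : Fin N → ℕ) cols := by
  obtain ⟨N, hN⟩ := (eventually_all.mpr fun i => eventually_all.mpr fun j =>
    h (rows i) (cols j)).exists
  refine ⟨N, Matrix.ext fun i j => ?_⟩
  rw [Matrix.submatrix_apply, hN i j,
    ← Fin.sum_univ_eq_sum_range fun l => A (rows i) l * B l (cols j)]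
  rfl

namespace MinorsIn

variable {P : Subsemiring S} {r : ℕ}

theorem mul (hA : MinorsIn (P : Set S) r A) (hB : MinorsIn (P : Set S) r B)
    (h : IsLocallyFiniteMul A B C) : MinorsIn (P : Set S) r C := by
  intro k hk rows cols hrows hcols
  obtain ⟨N, hN⟩ := h.exists_submatrix_eq_mul rows cols
  rw [hN, det_mul_cauchyBinet]
  have hval (s : Fin k ↪o Fin N) : StrictMono (Fin.val ∘ s) := Fin.val_strictMono.comp s.strictMono
  exact sum_mem fun s _ =>
    mul_mem (hA k hk rows _ hrows (hval s)) (hB k hk _ cols (hval s) hcols)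

theorem transpose {P : Set S} (hA : MinorsIn P r A) : MinorsIn P r A.transpose := by
  intro k hk rows cols hrows hcols
  rw [← Matrix.det_transpose]
  exact hA k hk cols rows hcols hrows

theorem map {T : Type*} [CommRing T] {P : Set S} {Q : Set T} (hA : MinorsIn P r A) (h : S →+* T)
    (hPQ : Set.MapsTo h P Q) : MinorsIn Q r (A.map h) := by
  intro k hk rows cols hrows hcols
  have hdet : ((A.map h).submatrix rows cols).det = h (A.submatrix rows cols).det :=
    (h.map_det (A.submatrix rows cols)).symm
  exact hdet ▸ hPQ (hA k hk rows cols hrows hcols)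

theorem scale_columns (hA : MinorsIn (P : Set S) r A) {v : ℕ → S} (hv : ∀ j, v j ∈ P) :
    MinorsIn (P : Set S) r (Matrix.of fun i j => v j * A i j) := by
  intro k hk rows cols hrows hcols
  have hdet : ((Matrix.of fun i j => v j * A i j).submatrix rows cols).det =
      (∏ j, v (cols j)) * (A.submatrix rows cols).det :=
    Matrix.det_mul_row (fun j => v (cols j)) (A.submatrix rows cols)
  exact hdet ▸ mul_mem (prod_mem fun j _ => hv _) (hA k hk rows cols hrows hcols)

end MinorsIn

end Minors

/-! ### Bidiagonal and tridiagonal matrices -/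

section Tridiagonal

variable {S : Type*} [CommRing S]

/-- The upper bidiagonal matrix with diagonal `d` and superdiagonal `u`. -/
def upperBidiag (d u : ℕ → S) : Matrix ℕ ℕ S :=
  Matrix.of fun i j => if j = i + 1 then u i else if j = i then d i else 0

lemma upperBidiag_eq_zero {d u : ℕ → S} {i j : ℕ} (h : j < i ∨ i + 1 < j) :
    upperBidiag d u i j = 0 := by
  rw [upperBidiag, Matrix.of_apply, if_neg (by omega), if_neg (by omega)]

theorem minorsIn_upperBidiag {P : Subsemiring S} {d u : ℕ → S} (hd : ∀ i, d i ∈ P)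
    (hu : ∀ i, u i ∈ P) (r : ℕ) : MinorsIn (P : Set S) r (upperBidiag d u) := by
  have hentry (i j : ℕ) : upperBidiag d u i j ∈ P := by
    rw [upperBidiag, Matrix.of_apply]
    split_ifs
    exacts [hu i, hd i, zero_mem P]
  intro k _
  induction k with
  | zero => simp [one_mem]
  | succ k ih =>
    intro rows cols hrows hcols
    have hdet : ((upperBidiag d u).submatrix rows cols).det =
        upperBidiag d u (rows 0) (cols 0) *
          ((upperBidiag d u).submatrix (rows ∘ Fin.succ) (cols ∘ Fin.succ)).det := by
      rcases lt_or_ge (rows 0) (cols 0) with h | h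
      · refine det_eq_mul_det_succ_of_row_zero fun j => upperBidiag_eq_zero (.inr ?_)
        exact h.succ_le.trans_lt (hcols j.succ_pos)
      · refine det_eq_mul_det_succ_of_column_zero fun i => upperBidiag_eq_zero (.inl ?_)
        exact h.trans_lt (hrows i.succ_pos)
    rw [hdet]
    exact mul_mem (hentry _ _) (ih (by omega) _ _ (hrows.comp Fin.strictMono_succ)
      (hcols.comp Fin.strictMono_succ))

/-- The tridiagonal matrix with diagonal `d`, superdiagonal `u` and subdiagonal `l`. -/
def tridiag (d u l : ℕ → S) : Matrix ℕ ℕ S :=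
  Matrix.of fun i j =>
    if j = i + 1 then u i else if j = i then d i else if i = j + 1 then l j else 0

lemma transpose_tridiag (d u l : ℕ → S) : (tridiag d u l).transpose = tridiag d l u := by
  ext i j
  simp only [tridiag, Matrix.transpose_apply, Matrix.of_apply]
  grind

theorem isLocallyFiniteMul_tridiag {d u l s q : ℕ → S} (hd₀ : d 0 = s 0)
    (hd : ∀ n, d (n + 1) = s (n + 1) + q n * u n) (hl : ∀ n, l n = q n * s n) :
    IsLocallyFiniteMul (upperBidiag 1 q).transpose (upperBidiag s u) (tridiag d u l) := by
  refine isLocallyFiniteMul_of_lowerTriangular (fun i j h => upperBidiag_eq_zero (.inl h)) ?_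
  rintro (_ | i) j
  · simp only [tridiag, upperBidiag, Matrix.transpose_apply, Matrix.of_apply, Pi.one_apply,
      zero_add, Finset.sum_range_one]
    grind
  · rw [Finset.sum_range_succ, Finset.sum_range_succ, Finset.sum_eq_zero, zero_add]
    · simp only [tridiag, upperBidiag, Matrix.transpose_apply, Matrix.of_apply, Pi.one_apply]
      grind
    · intro n hn
      have hn' : n < i := Finset.mem_range.mp hn
      rw [Matrix.transpose_apply, upperBidiag_eq_zero (.inr (by omega)), zero_mul]

end Tridiagonal

section DiagonallyDominant

variable {𝕜 : Type*} [Field 𝕜] [LinearOrder 𝕜] [IsStrictOrderedRing 𝕜] {d u l : ℕ → 𝕜}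

/-- The pivots of Gaussian elimination applied to `tridiag d u l`. Where a pivot vanishes, the
multiplier `l n / luPivot d u l n` is `0`, which is harmless as soon as `l n` vanishes too. -/
def luPivot (d u l : ℕ → 𝕜) : ℕ → 𝕜
  | 0 => d 0
  | n + 1 => d (n + 1) - l n / luPivot d u l n * u n

lemma le_luPivot (hu : ∀ n, 0 ≤ u n) (hl : ∀ n, 0 ≤ l n) (h₀ : l 0 ≤ d 0)
    (hdom : ∀ n, u n + l (n + 1) ≤ d (n + 1)) : ∀ n, l n ≤ luPivot d u l n
  | 0 => h₀
  | n + 1 => by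
    have ih := le_luPivot hu hl h₀ hdom n
    have hmul : l n / luPivot d u l n * u n ≤ u n :=
      mul_le_of_le_one_left (hu n) (div_le_one_of_le₀ ih ((hl n).trans ih))
    rw [luPivot]
    linarith [hdom n]

theorem minorsIn_tridiag_of_columnDominant (hu : ∀ n, 0 ≤ u n) (hl : ∀ n, 0 ≤ l n)
    (h₀ : l 0 ≤ d 0) (hdom : ∀ n, u n + l (n + 1) ≤ d (n + 1)) (r : ℕ) :
    MinorsIn (Subsemiring.nonneg 𝕜 : Set 𝕜) r (tridiag d u l) := by
  have hle := le_luPivot hu hl h₀ hdom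
  have hpivot (n : ℕ) : 0 ≤ luPivot d u l n := (hl n).trans (hle n)
  have hmul (n : ℕ) : l n = l n / luPivot d u l n * luPivot d u l n :=
    (div_mul_cancel_of_imp fun h => le_antisymm (h ▸ hle n) (hl n)).symm
  have hL : MinorsIn (Subsemiring.nonneg 𝕜 : Set 𝕜) r
      (upperBidiag 1 fun n => l n / luPivot d u l n).transpose :=
    .transpose <|
      minorsIn_upperBidiag (fun _ => zero_le_one) (fun n => div_nonneg (hl n) (hpivot n)) r
  have hU : MinorsIn (Subsemiring.nonneg 𝕜 : Set 𝕜) r (upperBidiag (luPivot d u l) u) :=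
    minorsIn_upperBidiag hpivot hu r
  exact hL.mul hU (isLocallyFiniteMul_tridiag rfl (fun n => by rw [luPivot]; ring) hmul)

theorem minorsIn_tridiagJ_of_columnDominant {ν ω a b c : 𝕜} (hω : 0 ≤ ω) (ha : 0 ≤ a) (hc : 0 ≤ c)
    (hων : ω ≤ ν) (hb : a + c ≤ b) (r : ℕ) :
    MinorsIn (Subsemiring.nonneg 𝕜 : Set 𝕜) r (tridiagJ ν ω a b c) := by
  refine minorsIn_tridiag_of_columnDominant (d := fun n => ν + n * b)
    (u := fun n => (n + 1) * a) (l := fun n => ω + n * c)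
    (fun n => by positivity) (fun n => by positivity) (by simpa using hων) (fun n => ?_) r
  have hn : (n + 1) * (a + c) ≤ (n + 1) * b := by gcongr
  push_cast
  linarith

theorem minorsIn_tridiagJ_of_rowDominant {ν ω a b c : 𝕜} (hω : 0 ≤ ω) (ha : 0 ≤ a) (hc : 0 ≤ c)
    (haν : a ≤ ν) (hb : max (a + c) (a + ω) ≤ b) (r : ℕ) :
    MinorsIn (Subsemiring.nonneg 𝕜 : Set 𝕜) r (tridiagJ ν ω a b c) := by
  obtain ⟨hac, haω⟩ := max_le_iff.mp hb
  have htr : MinorsIn (Subsemiring.nonneg 𝕜 : Set 𝕜) r (tridiag (fun n => ν + n * b)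
      (fun n => ω + n * c) fun n => (n + 1) * a) := by
    refine minorsIn_tridiag_of_columnDominant (fun n => by positivity) (fun n => by positivity)
      (by simpa using haν) (fun n => ?_) r
    have hn : n * (a + c) ≤ n * b := by gcongr
    push_cast
    linarith
  rw [← transpose_tridiag] at htr
  exact htr.transpose

end DiagonallyDominant

theorem minorsIn_tridiagJ_zero_zero {S : Type*} [CommRing S] {P : Subsemiring S} {ν a b : S}
    (hν : ν ∈ P) (ha : a ∈ P) (hb : b ∈ P) (r : ℕ) :
    MinorsIn (P : Set S) r (tridiagJ ν 0 a b 0) := by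
  have hbidiag : tridiagJ ν 0 a b 0 =
      upperBidiag (fun n => ν + (n : S) * b) fun n => ((n : S) + 1) * a := by
    ext i j
    simp [tridiagJ, upperBidiag]
  rw [hbidiag]
  exact minorsIn_upperBidiag (fun n => add_mem hν (mul_mem (natCast_mem _ n) hb))
    (fun n => mul_mem (add_mem (natCast_mem _ n) (one_mem _)) ha) r

/-! ### Production matrices -/

section Production

variable {S : Type*} [CommRing S] {P : Subsemiring S} {r : ℕ} {C Q : Matrix ℕ ℕ S}

lemma MinorsIn.of_submatrix_succ (h₀ : C 0 = Pi.single 0 1)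
    (hC : MinorsIn (P : Set S) r (C.submatrix Nat.succ id)) : MinorsIn (P : Set S) r C := by
  have hpos {k : ℕ} (hk : k ≤ r) {rows cols : Fin k → ℕ} (hrows : StrictMono rows)
      (hcols : StrictMono cols) (hp : ∀ i, 0 < rows i) : (C.submatrix rows cols).det ∈ P := by
    have hpred : StrictMono fun i => rows i - 1 := fun i j hij =>
      Nat.sub_lt_sub_right (hp i) (hrows hij)
    have hsub : C.submatrix rows cols =
        (C.submatrix Nat.succ id).submatrix (fun i => rows i - 1) cols := by
      ext i j
      simp [Nat.sub_add_cancel (hp i)]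
    exact hsub ▸ hC k hk _ cols hpred hcols
  intro k hk rows cols hrows hcols
  rcases k with _ | k
  · exact hpos hk hrows hcols fun i => i.elim0
  rcases Nat.eq_zero_or_pos (rows 0) with hr | hr
  · have hrow (j : Fin k) : C.submatrix rows cols 0 j.succ = 0 := by
      simp [hr, h₀, (Nat.zero_le _).trans_lt (hcols j.succ_pos) |>.ne']
    have hcorner : C.submatrix rows cols 0 0 ∈ P := by
      rw [Matrix.submatrix_apply, hr, h₀, Pi.single_apply]
      split_ifs
      exacts [one_mem P, zero_mem P]
    rw [det_eq_mul_det_succ_of_row_zero hrow]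
    exact mul_mem hcorner (hpos (by omega) (hrows.comp Fin.strictMono_succ)
      (hcols.comp Fin.strictMono_succ) fun i => (Nat.zero_le _).trans_lt (hrows i.succ_pos))
  · exact hpos hk hrows hcols fun i => hr.trans_le (hrows.monotone i.zero_le)

theorem MinorsIn.of_row_recurrence (h₀ : C 0 = Pi.single 0 1)
    (h : IsLocallyFiniteMul C Q (C.submatrix Nat.succ id)) (hQ : MinorsIn (P : Set S) r Q) :
    MinorsIn (P : Set S) r C := by
  have htrunc (m : ℕ) :
      MinorsIn (P : Set S) r (Matrix.of fun i j => if i < m then C i j else 0) := by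
    induction m with
    | zero =>
      have hzero : (Matrix.of fun i j => if i < 0 then C i j else 0) = upperBidiag 0 0 := by
        ext i j
        simp [upperBidiag]
      exact hzero ▸ minorsIn_upperBidiag (fun _ => zero_mem P) (fun _ => zero_mem P) r
    | succ m ih =>
      refine .of_submatrix_succ (by ext j; simp [h₀]) (ih.mul hQ fun i j => ?_)
      filter_upwards [h i j] with N hN
      by_cases hi : i < m
      · simpa [hi] using hN
      · simp [hi]
  intro k hk rows cols hrows hcols
  obtain ⟨m, hm⟩ := (eventually_all.mpr fun i => eventually_gt_atTop (rows i)).exists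
  have hsub : C.submatrix rows cols =
      (Matrix.of fun i j => if i < m then C i j else 0).submatrix rows cols := by
    ext i j
    simp [hm i]
  exact hsub ▸ htrunc m k hk rows cols hrows hcols

/-- The row-finite infinite matrix of an endomorphism acting on row vectors: row `i` is the image
of the `i`-th basis vector. -/
noncomputable def rowMatrix (T : Module.End S (ℕ →₀ S)) : Matrix ℕ ℕ S :=
  Matrix.of fun i k => T (Finsupp.single i 1) k

/-- The output matrix of the production matrix `rowMatrix T`: row `n` is row `0` of its `n`-th
power. -/
noncomputable def outputMat (T : Module.End S (ℕ →₀ S)) : Matrix ℕ ℕ S :=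
  Matrix.of fun n k => (T ^ n) (Finsupp.single 0 1) k

/-- The input matrix of the production matrix `rowMatrix T`: column `n` is column `0` of its `n`-th
power. -/
noncomputable def inputMat (T : Module.End S (ℕ →₀ S)) : Matrix ℕ ℕ S :=
  Matrix.of fun k n => (T ^ n) (Finsupp.single k 1) 0

lemma exists_rowMatrix_eq (hQ : ∀ i, (Function.support (Q i)).Finite) :
    ∃ T : Module.End S (ℕ →₀ S), rowMatrix T = Q := by
  refine ⟨Finsupp.linearCombination S fun i => Finsupp.ofSupportFinite (Q i) (hQ i), ?_⟩
  ext i k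
  simp [rowMatrix, Finsupp.ofSupportFinite_coe]

lemma eventually_eq_sum_range_mul_single (L : (ℕ →₀ S) →ₗ[S] S) (v : ℕ →₀ S) :
    ∀ᶠ N in atTop, L v = ∑ l ∈ Finset.range N, v l * L (Finsupp.single l 1) := by
  obtain ⟨N₀, hN₀⟩ := v.support.exists_nat_subset_range
  filter_upwards [eventually_ge_atTop N₀] with N hN
  have hv : v = ∑ l ∈ Finset.range N, v l • Finsupp.single l 1 := by
    conv_lhs => rw [← v.sum_single,
      Finsupp.sum_of_support_subset v (hN₀.trans (Finset.range_mono hN)) _ (by simp)]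
    simp
  conv_lhs => rw [hv]
  simp only [map_sum, map_smul, smul_eq_mul]

variable (T : Module.End S (ℕ →₀ S))

lemma isLocallyFiniteMul_outputMat_rowMatrix :
    IsLocallyFiniteMul (outputMat T) (rowMatrix T) ((outputMat T).submatrix Nat.succ id) :=
  fun n k => by
    simpa [outputMat, rowMatrix, pow_succ'] using
      eventually_eq_sum_range_mul_single (Finsupp.lapply k ∘ₗ T) ((T ^ n) (Finsupp.single 0 1))

lemma isLocallyFiniteMul_rowMatrix_inputMat :
    IsLocallyFiniteMul (rowMatrix T) (inputMat T) ((inputMat T).submatrix id Nat.succ) :=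
  fun k n => by
    simpa [inputMat, rowMatrix, pow_succ] using
      eventually_eq_sum_range_mul_single (Finsupp.lapply 0 ∘ₗ T ^ n) (T (Finsupp.single k 1))

lemma isLocallyFiniteMul_outputMat_inputMat :
    IsLocallyFiniteMul (outputMat T) (inputMat T) (hankelMat fun n => outputMat T n 0) :=
  fun i j => by
    have hpow : T ^ (i + j) = T ^ j * T ^ i := by rw [add_comm, pow_add]
    simpa [outputMat, inputMat, hankelMat, hpow] using
      eventually_eq_sum_range_mul_single (Finsupp.lapply 0 ∘ₗ T ^ j) ((T ^ i) (Finsupp.single 0 1))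

variable {T}

theorem minorsIn_outputMat (hT : MinorsIn (P : Set S) r (rowMatrix T)) :
    MinorsIn (P : Set S) r (outputMat T) := by
  refine .of_row_recurrence ?_ (isLocallyFiniteMul_outputMat_rowMatrix T) hT
  ext k
  simp [outputMat, Finsupp.single_apply, Pi.single_apply, eq_comm]

theorem minorsIn_inputMat (hT : MinorsIn (P : Set S) r (rowMatrix T)) :
    MinorsIn (P : Set S) r (inputMat T) := by
  suffices h : MinorsIn (P : Set S) r (inputMat T).transpose from h.transpose
  refine .of_row_recurrence ?_ (isLocallyFiniteMul_rowMatrix_inputMat T).transpose hT.transpose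
  ext k
  simp [inputMat, Finsupp.single_apply, Pi.single_apply]

theorem minorsIn_hankelMat_outputMat (hT : MinorsIn (P : Set S) r (rowMatrix T)) :
    MinorsIn (P : Set S) r (hankelMat fun n => outputMat T n 0) :=
  (minorsIn_outputMat hT).mul (minorsIn_inputMat hT) (isLocallyFiniteMul_outputMat_inputMat T)

end Production

/-! ### Production matrices of exponential Riordan arrays -/

section Riordan

open PowerSeries

/-- The differential equations which hold for the exponential Riordan array `(g, f)` with associated
series `Z` and `A`. They do not mention the compositional inverse of `f`. -/
structure IsRiordanPair {K : Type*} [CommRing K] (g f Z A : PowerSeries K) : Prop where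
  constantCoeff_fst : constantCoeff g = 1
  constantCoeff_snd : constantCoeff f = 0
  derivative_fst : derivative K g = g * subst f Z
  derivative_snd : derivative K f = subst f A

theorem IsExpRiordanArray.exists_isRiordanPair {K : Type*} [Field K] {R : Matrix ℕ ℕ K}
    {Z A : PowerSeries K} (h : IsExpRiordanArray R Z A) :
    ∃ g f, IsRiordanPair g f Z A ∧ R = expRiordan g f := by
  obtain ⟨g, f, fbar, hg, hf, -, hfbar, -, hinv, hZ, hA, hR⟩ := h
  have hsf : HasSubst f := .of_constantCoeff_zero' hf
  have hcancel (p : PowerSeries K) : subst f (subst fbar p) = p := by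
    rw [subst_comp_subst_apply (.of_constantCoeff_zero' hfbar) hsf, hinv, X_subst]
  have hunit : constantCoeff (subst fbar g) ≠ 0 := fun h₀ => by
    have h₁ := constantCoeff_subst_eq_zero hf (subst fbar g) h₀
    rw [hcancel] at h₁
    exact one_ne_zero (hg.symm.trans h₁)
  refine ⟨g, f, ⟨hg, hf, ?_, ?_⟩, hR⟩
  · calc derivative K g = subst f (subst fbar (derivative K g)) := (hcancel _).symm
      _ = subst f (Z * subst fbar g) := by
        rw [hZ, mul_assoc, PowerSeries.inv_mul_cancel _ hunit, mul_one]
      _ = g * subst f Z := by rw [subst_mul hsf, hcancel, mul_comm]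
  · rw [hA, hcancel]

section CommRing

variable {K : Type*} [CommRing K] {g f Z A : PowerSeries K}

theorem IsRiordanPair.derivative_mul_subst (h : IsRiordanPair g f Z A) (p : PowerSeries K) :
    derivative K (g * subst f p) = g * subst f (Z * p + A * derivative K p) := by
  have hsf : HasSubst f := .of_constantCoeff_zero' h.constantCoeff_snd
  rw [Derivation.leibniz, derivative_subst hsf, h.derivative_fst, h.derivative_snd, subst_add hsf,
    subst_mul hsf, subst_mul hsf]
  simp only [smul_eq_mul]
  ring

lemma coeff_mul_subst (hf : constantCoeff f = 0) (g p : PowerSeries K) {n N : ℕ} (hN : n < N) :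
    coeff n (g * subst f p) = ∑ i ∈ Finset.range N, coeff i p * coeff n (g * f ^ i) := by
  have hsf : HasSubst f := .of_constantCoeff_zero' hf
  have htail : coeff n (g * (f ^ N * subst f (mk fun i => coeff (i + N) p))) = 0 := by
    refine X_pow_dvd_iff.mp ?_ n hN
    exact ((pow_dvd_pow_of_dvd (X_dvd_iff.mpr hf) N).mul_right _).mul_left g
  conv_lhs => rw [eq_X_pow_mul_shift_add_trunc N p]
  rw [subst_add hsf, subst_mul hsf, subst_pow hsf, subst_X hsf, subst_coe hsf, mul_add, map_add,
    htail, zero_add, trunc_apply, map_sum, Finset.mul_sum, map_sum, Nat.Ico_zero_eq_range]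
  refine Finset.sum_congr rfl fun i _ => ?_
  rw [Polynomial.aeval_monomial, mul_left_comm, ← Algebra.smul_def, map_smul, smul_eq_mul]

/-- The production matrix of an exponential Riordan array with associated series `Z` and `A`, up to
conjugation by the diagonal matrix of factorials: column `k` is generated by `Z t ^ k + A (t ^ k)'`,
where the paper has the same expression divided by `k!`. -/
noncomputable def productionMatrix (Z A : PowerSeries K) : Matrix ℕ ℕ K :=
  Matrix.of fun i k => coeff i (Z * X ^ k + A * derivative K (X ^ k))

lemma finite_support_productionMatrix (Z A : PowerSeries K) (i : ℕ) :
    (Function.support (productionMatrix Z A i)).Finite := by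
  refine (Set.finite_Iic (i + 1)).subset fun k hk => ?_
  contrapose! hk
  simp only [Set.mem_Iic, not_le] at hk
  have hdvd : X ^ (i + 1) ∣ Z * X ^ k + A * derivative K (X ^ k) := by
    refine dvd_add ((pow_dvd_pow X (by omega)).mul_left Z) (.mul_left ?_ A)
    rw [derivative_pow]
    exact ((pow_dvd_pow X (by omega)).mul_left _).mul_right _
  simpa [productionMatrix] using X_pow_dvd_iff.mp hdvd i (Nat.lt_succ_self i)

lemma map_productionMatrix {L : Type*} [CommRing L] (h : K →+* L) (Z A : PowerSeries K) :
    (productionMatrix Z A).map h = productionMatrix (Z.map h) (A.map h) := by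
  ext i k
  simp [productionMatrix, ← coeff_map]

theorem IsRiordanPair.coeff_succ_mul_pow (h : IsRiordanPair g f Z A) {n N : ℕ} (hN : n < N)
    (k : ℕ) : coeff (n + 1) (g * f ^ k) * (n + 1) =
      ∑ i ∈ Finset.range N, productionMatrix Z A i k * coeff n (g * f ^ i) := by
  have hsf : HasSubst f := .of_constantCoeff_zero' h.constantCoeff_snd
  have hpow : f ^ k = subst f (X ^ k : PowerSeries K) := by rw [subst_pow hsf, subst_X hsf]
  rw [hpow, ← coeff_derivative, h.derivative_mul_subst, coeff_mul_subst h.constantCoeff_snd _ _ hN]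
  rfl

end CommRing

section Toeplitz

variable {S : Type*} [CommRing S]

/-- The lower triangular Toeplitz matrix of a power series over a commutative ring. Over `ℝ` it is
`toeplitzMat`. -/
noncomputable def lowerToeplitz (φ : PowerSeries S) : Matrix ℕ ℕ S :=
  Matrix.of fun i j => if j ≤ i then coeff (i - j) φ else 0

lemma map_lowerToeplitz {T : Type*} [CommRing T] (h : S →+* T) (φ : PowerSeries S) :
    (lowerToeplitz φ).map h = lowerToeplitz (φ.map h) := by
  ext i j
  simp [lowerToeplitz, apply_ite h]

lemma isLocallyFiniteMul_lowerToeplitz {φ : PowerSeries S} {B C : Matrix ℕ ℕ S}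
    (h : ∀ j, mk (fun i => C i j) = φ * mk fun i => B i j) :
    IsLocallyFiniteMul (lowerToeplitz φ) B C := by
  refine isLocallyFiniteMul_of_lowerTriangular (fun i l hl => if_neg hl.not_ge) fun i j => ?_
  rw [← coeff_mk i fun i => C i j, h, mul_comm, coeff_mul,
    Finset.Nat.sum_antidiagonal_eq_sum_range_succ_mk]
  refine Finset.sum_congr rfl fun l hl => ?_
  rw [lowerToeplitz, Matrix.of_apply, if_pos (Finset.mem_range_succ_iff.mp hl), coeff_mk, mul_comm]

lemma mk_tridiagJ_column (ν ω a b c : S) (k : ℕ) :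
    mk (fun i => tridiagJ ν ω a b c i k) =
      (C ν + C ω * X) * X ^ k + (C a + C b * X + C c * X ^ 2) * derivative S (X ^ k) := by
  rcases k with _ | k
  · ext i
    rcases i with _ | _ | i <;> simp [tridiagJ, coeff_C]
  calc mk (fun i => tridiagJ ν ω a b c i (k + 1))
      = C ((k + 1) * a) * X ^ k + C (ν + (k + 1) * b) * X ^ (k + 1) +
          C (ω + (k + 1) * c) * X ^ (k + 2) := by
        ext i
        simp only [tridiagJ, Matrix.of_apply, coeff_mk, LinearMap.map_add, coeff_C_mul, coeff_X_pow]
        rcases eq_or_ne i (k + 1) with rfl | hi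
        · simp
        · grind
    _ = (C ν + C ω * X) * X ^ (k + 1) +
          (C a + C b * X + C c * X ^ 2) * derivative S (X ^ (k + 1)) := by
        simp
        ring

theorem isLocallyFiniteMul_lowerToeplitz_tridiagJ (φ : PowerSeries S) (ν ω a b c : S) :
    IsLocallyFiniteMul (lowerToeplitz φ) (tridiagJ ν ω a b c)
      (productionMatrix (zSeries ν ω φ) (aSeries a b c φ)) := by
  refine isLocallyFiniteMul_lowerToeplitz fun k => ?_
  rw [mk_tridiagJ_column]
  ext i
  rw [coeff_mk, productionMatrix, Matrix.of_apply, zSeries, aSeries]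
  congr 1
  ring

end Toeplitz

theorem IsRiordanPair.map_outputMat {S K : Type*} [CommRing S] [CommRing K] (h : S →+* K)
    {g f : PowerSeries K} {Z A : PowerSeries S} (hgf : IsRiordanPair g f (Z.map h) (A.map h))
    {T : Module.End S (ℕ →₀ S)} (hT : rowMatrix T = productionMatrix Z A) (n k : ℕ) :
    h (outputMat T n k) = n.factorial * coeff n (g * f ^ k) := by
  induction n generalizing k with
  | zero =>
    rcases k with _ | k
    · simp [outputMat, hgf.constantCoeff_fst]
    · simp [outputMat, hgf.constantCoeff_snd]
  | succ n ih =>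
    obtain ⟨N, hN, hnN⟩ :=
      ((isLocallyFiniteMul_outputMat_rowMatrix T n k).and (eventually_gt_atTop n)).exists
    calc h (outputMat T (n + 1) k)
        = ∑ i ∈ Finset.range N, h (outputMat T n i) * h (productionMatrix Z A i k) := by
          simpa [hT] using congrArg h hN
      _ = n.factorial * ∑ i ∈ Finset.range N,
            productionMatrix (Z.map h) (A.map h) i k * coeff n (g * f ^ i) := by
          rw [Finset.mul_sum, ← map_productionMatrix]
          refine Finset.sum_congr rfl fun i _ => ?_
          rw [ih, Matrix.map_apply]
          ring
      _ = (n + 1).factorial * coeff (n + 1) (g * f ^ k) := by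
          rw [← hgf.coeff_succ_mul_pow hnN, Nat.factorial_succ]
          push_cast
          ring

theorem IsExpRiordanArray.exists_minorsIn {S K : Type*} [CommRing S] [Field K] [Algebra S K]
    {P : Subsemiring S} (hP : ∀ n : ℕ, n ≠ 0 → ∃ u ∈ P, n * u = 1) {φ : PowerSeries S}
    {ν ω a b c : S} {R : Matrix ℕ ℕ K}
    (hR : IsExpRiordanArray R ((zSeries ν ω φ).map (algebraMap S K))
      ((aSeries a b c φ).map (algebraMap S K))) :
    ∃ M : Matrix ℕ ℕ S, R = M.map (algebraMap S K) ∧ ∀ r,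
      MinorsIn (P : Set S) r (lowerToeplitz φ) → MinorsIn (P : Set S) r (tridiagJ ν ω a b c) →
        MinorsIn (P : Set S) r M ∧ MinorsIn (P : Set S) r (hankelMat fun n => M n 0) := by
  obtain ⟨g, f, hgf, rfl⟩ := hR.exists_isRiordanPair
  obtain ⟨T, hT⟩ := exists_rowMatrix_eq
    (finite_support_productionMatrix (zSeries ν ω φ) (aSeries a b c φ))
  choose u hu hmul using fun k : ℕ => hP k.factorial k.factorial_ne_zero
  have hu₀ : u 0 = 1 := by simpa using hmul 0
  refine ⟨Matrix.of fun n k => u k * outputMat T n k, ?_, fun r hφ hJ => ?_⟩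
  · ext n k
    have hinv : (k.factorial : K)⁻¹ = algebraMap S K (u k) :=
      inv_eq_of_mul_eq_one_right (by simpa using congrArg (algebraMap S K) (hmul k))
    simp only [expRiordan, Matrix.map_apply, Matrix.of_apply, map_mul, ← hinv,
      hgf.map_outputMat _ hT]
    ring
  · have hQ : MinorsIn (P : Set S) r (rowMatrix T) :=
      hT ▸ hφ.mul hJ (isLocallyFiniteMul_lowerToeplitz_tridiagJ φ ν ω a b c)
    exact ⟨(minorsIn_outputMat hQ).scale_columns hu,
      by simpa [hu₀] using minorsIn_hankelMat_outputMat hQ⟩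

section PolynomialSymbol

variable {K : Type*} [CommRing K]

/-- The operator `p ↦ Z p + A p'` on polynomials, which a Riordan array with associated series `Z`
and `A` intertwines with differentiation. -/
noncomputable def productionOperator (Z A : Polynomial K) : Polynomial K →ₗ[K] Polynomial K :=
  LinearMap.mulLeft K Z + LinearMap.mulLeft K A ∘ₗ Polynomial.derivative

lemma productionOperator_apply (Z A p : Polynomial K) :
    productionOperator Z A p = Z * p + A * Polynomial.derivative p := rfl

/-- The series `∑ n! [t ^ n] (g p(f)) t ^ n`. For `p = t ^ k` it is `k!` times the generating
function of column `k` of the Riordan array `(g, f)`. -/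
noncomputable def riordanColumns (g f : PowerSeries K) (p : Polynomial K) : PowerSeries K :=
  mk fun n => n.factorial * coeff n (g * Polynomial.aeval f p)

theorem IsRiordanPair.riordanColumns_eq {g f : PowerSeries K} {Z A : Polynomial K}
    (h : IsRiordanPair g f Z A) (p : Polynomial K) :
    riordanColumns g f p =
      C (p.coeff 0) + X * riordanColumns g f (productionOperator Z A p) := by
  have hsf : HasSubst f := .of_constantCoeff_zero' h.constantCoeff_snd
  ext n
  rcases n with _ | n
  · have hconst : constantCoeff (Polynomial.aeval f p) = p.coeff 0 := by
      rw [Polynomial.aeval_def, Polynomial.hom_eval₂, h.constantCoeff_snd,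
        Polynomial.eval₂_at_zero]
      simp
    simp [riordanColumns, h.constantCoeff_fst, hconst]
  · have hD : derivative K (g * Polynomial.aeval f p) =
        g * Polynomial.aeval f (productionOperator Z A p) := by
      simpa only [← subst_coe hsf, productionOperator_apply, Polynomial.coe_add,
        Polynomial.coe_mul, derivative_coe] using h.derivative_mul_subst p
    rw [map_add, coeff_succ_X_mul, coeff_C, if_neg n.succ_ne_zero, zero_add, riordanColumns,
      riordanColumns, coeff_mk, coeff_mk, ← hD, coeff_derivative, Nat.factorial_succ]
    push_cast
    ring

lemma eq_of_eq_C_add_X_mul {S V : Type*} [CommRing S] {c : V → S} {D : V → V}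
    {u v : V → PowerSeries S} (hu : ∀ p, u p = C (c p) + X * u (D p))
    (hv : ∀ p, v p = C (c p) + X * v (D p)) : u = v := by
  ext p n
  induction n generalizing p with
  | zero => rw [hu, hv]; simp
  | succ n ih => rw [hu, hv, map_add, map_add, coeff_succ_X_mul, coeff_succ_X_mul, ih]

end PolynomialSymbol

end Riordan

/-! ### Functional equations of branched continued fractions -/

section Branched

open PowerSeries

lemma dvd_prod_sub_prod {S ι : Type*} [CommRing S] {a : S} {s : Finset ι} {p q : ι → S}
    (h : ∀ i ∈ s, a ∣ p i - q i) : a ∣ ∏ i ∈ s, p i - ∏ i ∈ s, q i := by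
  simp only [← Ideal.mem_span_singleton, ← Ideal.Quotient.mk_eq_mk_iff_sub_mem] at h ⊢
  simpa only [map_prod] using Finset.prod_congr rfl h

variable {F : Type*} [Field F]

lemma one_sub_C_mul_X_mul_inv (a : F) (p : PowerSeries F) :
    (1 - C a * X * p)⁻¹ = 1 + C a * X * ((1 - C a * X * p)⁻¹ * p) := by
  have hinv : (1 - C a * X * p)⁻¹ * (1 - C a * X * p) = 1 :=
    PowerSeries.inv_mul_cancel _ (by simp)
  linear_combination hinv

lemma X_pow_succ_dvd_inv_sub_inv (a : F) {p q : PowerSeries F} {d : ℕ} (h : X ^ d ∣ p - q) :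
    X ^ (d + 1) ∣ (1 - C a * X * p)⁻¹ - (1 - C a * X * q)⁻¹ := by
  obtain ⟨w, hw⟩ := h
  have hp : (1 - C a * X * p)⁻¹ * (1 - C a * X * p) = 1 :=
    PowerSeries.inv_mul_cancel _ (by simp)
  have hq : (1 - C a * X * q)⁻¹ * (1 - C a * X * q) = 1 :=
    PowerSeries.inv_mul_cancel _ (by simp)
  set u := (1 - C a * X * p)⁻¹
  set v := (1 - C a * X * q)⁻¹
  exact ⟨u * v * C a * w, by linear_combination -u * hq + v * hp + u * v * C a * X * hw⟩

variable (m : ℕ) (α : ℕ → F)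

lemma X_pow_dvd_branchedSTrunc_succ_sub (d k : ℕ) :
    X ^ d ∣ branchedSTrunc m α (d + 1) k - branchedSTrunc m α d k := by
  induction d generalizing k with
  | zero => simp
  | succ d ih =>
    rw [branchedSTrunc, branchedSTrunc]
    exact X_pow_succ_dvd_inv_sub_inv _ (dvd_prod_sub_prod fun i _ => ih _)

/-- The value of the branched continued fraction started at position `k`: the coefficientwise limit
of `branchedSTrunc m α d k` as `d` tends to infinity. -/
noncomputable def branchedSLimit (k : ℕ) : PowerSeries F :=
  mk fun n => coeff n (branchedSTrunc m α (n + 1) k)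

lemma coeff_branchedSTrunc {n d : ℕ} (h : n < d) (k : ℕ) :
    coeff n (branchedSTrunc m α d k) = coeff n (branchedSLimit m α k) := by
  rw [branchedSLimit, coeff_mk]
  induction d, h using Nat.le_induction with
  | base => rfl
  | succ d hd ih =>
    rw [← ih, ← sub_eq_zero, ← map_sub]
    exact X_pow_dvd_iff.mp (X_pow_dvd_branchedSTrunc_succ_sub m α d k) n hd

lemma X_pow_dvd_branchedSLimit_sub (d k : ℕ) :
    X ^ d ∣ branchedSLimit m α k - branchedSTrunc m α d k :=
  X_pow_dvd_iff.mpr fun n hn => by rw [map_sub, coeff_branchedSTrunc m α hn, sub_self]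

theorem branchedSLimit_eq_inv (k : ℕ) : branchedSLimit m α k =
    (1 - C (α (m + k)) * X * ∏ i : Fin m, branchedSLimit m α (k + ((i : ℕ) + 1)))⁻¹ := by
  ext n
  have hdvd := X_pow_succ_dvd_inv_sub_inv (α (m + k)) <|
    dvd_prod_sub_prod (s := (Finset.univ : Finset (Fin m))) fun i _ =>
      X_pow_dvd_branchedSLimit_sub m α n (k + ((i : ℕ) + 1))
  have hcoeff := X_pow_dvd_iff.mp hdvd n (Nat.lt_succ_self n)
  rw [map_sub, sub_eq_zero] at hcoeff
  rw [hcoeff, ← coeff_branchedSTrunc m α (Nat.lt_succ_self n), branchedSTrunc]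

/-- The product of the continued fractions started at the positions `0, …, k - 1`. -/
noncomputable def branchedSProd (k : ℕ) : PowerSeries F :=
  ∏ i ∈ Finset.range k, branchedSLimit m α i

theorem branchedSProd_succ (k : ℕ) : branchedSProd m α (k + 1) =
    branchedSProd m α k + C (α (m + k)) * X * branchedSProd m α (k + m + 1) := by
  have hlimit : branchedSLimit m α k = 1 + C (α (m + k)) * X *
      (branchedSLimit m α k * ∏ i : Fin m, branchedSLimit m α (k + ((i : ℕ) + 1))) := by
    rw [branchedSLimit_eq_inv, ← one_sub_C_mul_X_mul_inv]
  have hprod : branchedSProd m α (k + m + 1) = branchedSProd m α k *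
      (branchedSLimit m α k * ∏ i : Fin m, branchedSLimit m α (k + ((i : ℕ) + 1))) := by
    rw [Fin.prod_univ_eq_prod_range fun i => branchedSLimit m α (k + (i + 1)), branchedSProd,
      add_assoc k, Finset.prod_range_add, Finset.prod_range_succ', branchedSProd, add_zero]
    ring
  rw [hprod, branchedSProd, Finset.prod_range_succ, ← branchedSProd]
  linear_combination branchedSProd m α k * hlimit

/-- The linear map sending `t ^ k` to `k!` times the generating function of column `k` of the
Riordan array of part (v), as expressed by branched continued fractions. -/
noncomputable def branchedColumns : Polynomial F →ₗ[F] PowerSeries F :=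
  (Polynomial.basisMonomials F).constr F fun k =>
    C (k.factorial : F) * X ^ k * branchedSProd m α (k * (m + 1) + 1)

lemma branchedColumns_X_pow (k : ℕ) : branchedColumns m α (Polynomial.X ^ k) =
    C (k.factorial : F) * X ^ k * branchedSProd m α (k * (m + 1) + 1) := by
  rw [← Polynomial.monomial_one_right_eq_X_pow, ← congrFun (Polynomial.coe_basisMonomials F) k]
  exact (Polynomial.basisMonomials F).constr_basis F _ k

variable {m α} {x : Fin m → F}

theorem branchedColumns_X_pow_mul_prod
    (hα : ∀ (q : ℕ) (i : Fin m), α (m + q * (m + 1) + ((i : ℕ) + 1)) = ((q : F) + 1) * x i)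
    {i : ℕ} (hi : i ≤ m) (k : ℕ) :
    branchedColumns m α (Polynomial.X ^ k *
        ∏ j : Fin i, (1 + Polynomial.C (x (j.castLE hi)) * Polynomial.X)) =
      C (k.factorial : F) * X ^ k * branchedSProd m α (k * (m + 1) + i + 1) := by
  induction i generalizing k with
  | zero => simpa using branchedColumns_X_pow m α k
  | succ i ih =>
    have hi' : i ≤ m := i.le_succ.trans hi
    have hsplit : Polynomial.X ^ k *
          ∏ j : Fin (i + 1), (1 + Polynomial.C (x (j.castLE hi)) * Polynomial.X) =
        Polynomial.X ^ k * ∏ j : Fin i, (1 + Polynomial.C (x (j.castLE hi')) * Polynomial.X) +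
          x ⟨i, hi⟩ • (Polynomial.X ^ (k + 1) *
            ∏ j : Fin i, (1 + Polynomial.C (x (j.castLE hi')) * Polynomial.X)) := by
      rw [Fin.prod_univ_castSucc, Polynomial.smul_eq_C_mul]
      simp only [Fin.castLE, Fin.val_castSucc, Fin.val_last]
      ring
    have hindex : k * (m + 1) + (i + 1) + m + 1 = (k + 1) * (m + 1) + i + 1 := by ring
    have hcoeff : α (m + (k * (m + 1) + (i + 1))) = (k + 1) * x ⟨i, hi⟩ := by
      rw [← add_assoc m]
      exact hα k ⟨i, hi⟩
    rw [hsplit, map_add, map_smul, ih hi', ih hi', branchedSProd_succ m α (k * (m + 1) + (i + 1)),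
      hcoeff, hindex, smul_eq_C_mul, Nat.factorial_succ]
    push_cast
    simp only [map_mul, map_add, map_one, ← add_assoc]
    ring

lemma branchedColumns_X_pow_eq {ν b : F} (hα₀ : ∀ q : ℕ, α (m + q * (m + 1)) = ν + q * b)
    {φ : Polynomial F} (hφ : ∀ k, branchedColumns m α (Polynomial.X ^ k * φ) =
      C (k.factorial : F) * X ^ k * branchedSProd m α (k * (m + 1) + m + 1)) (k : ℕ) :
    branchedColumns m α (Polynomial.X ^ k) = C ((Polynomial.X ^ k : Polynomial F).coeff 0) +
      X * branchedColumns m α (productionOperator (Polynomial.C ν * φ)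
        ((1 + Polynomial.C b * Polynomial.X) * φ) (Polynomial.X ^ k)) := by
  rw [branchedColumns_X_pow, branchedSProd_succ, hα₀, productionOperator_apply]
  rcases k with _ | k
  · have hD : Polynomial.C ν * φ * Polynomial.X ^ 0 + (1 + Polynomial.C b * Polynomial.X) * φ *
        Polynomial.derivative (Polynomial.X ^ 0) = ν • (Polynomial.X ^ 0 * φ) := by
      simp [Polynomial.smul_eq_C_mul]
    rw [hD, map_smul, hφ, smul_eq_C_mul]
    simp [branchedSProd]
    ring
  · have hD : Polynomial.C ν * φ * Polynomial.X ^ (k + 1) +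
          (1 + Polynomial.C b * Polynomial.X) * φ *
            Polynomial.derivative (Polynomial.X ^ (k + 1)) =
        (ν + (k + 1 : ℕ) * b) • (Polynomial.X ^ (k + 1) * φ) +
          ((k + 1 : ℕ) : F) • (Polynomial.X ^ k * φ) := by
      simp only [Polynomial.smul_eq_C_mul, Polynomial.derivative_X_pow, Nat.add_sub_cancel,
        map_add, map_mul]
      ring
    have hindex : (k + 1) * (m + 1) = k * (m + 1) + m + 1 := by ring
    rw [hD, map_add (branchedColumns m α), map_smul, map_smul, hφ, hφ, smul_eq_C_mul,
      smul_eq_C_mul, Nat.factorial_succ, hindex]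
    simp only [Nat.cast_mul, map_mul, Polynomial.coeff_X_pow, (Nat.succ_ne_zero k).symm,
      if_false, map_zero]
    ring

theorem branchedColumns_eq {ν b : F} (hα₀ : ∀ q : ℕ, α (m + q * (m + 1)) = ν + q * b)
    (hα : ∀ (q : ℕ) (i : Fin m), α (m + q * (m + 1) + ((i : ℕ) + 1)) = ((q : F) + 1) * x i)
    {φ : Polynomial F} (hφ : φ = ∏ i : Fin m, (1 + Polynomial.C (x i) * Polynomial.X))
    (p : Polynomial F) :
    branchedColumns m α p = C (p.coeff 0) + X * branchedColumns m α
      (productionOperator (Polynomial.C ν * φ) ((1 + Polynomial.C b * Polynomial.X) * φ) p) := by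
  have hmonomial := branchedColumns_X_pow_eq hα₀ (φ := φ)
    (hφ ▸ branchedColumns_X_pow_mul_prod hα le_rfl)
  set D := productionOperator (Polynomial.C ν * φ) ((1 + Polynomial.C b * Polynomial.X) * φ)
  induction p using Polynomial.induction_on' with
  | add p q hp hq =>
    rw [map_add, hp, hq, map_add D, map_add (branchedColumns m α), Polynomial.coeff_add, map_add]
    ring
  | monomial k c =>
    rw [← mul_one c, ← smul_eq_mul, ← Polynomial.smul_monomial,
      Polynomial.monomial_one_right_eq_X_pow, map_smul, hmonomial, map_smul D, map_smul,
      Polynomial.coeff_smul, smul_eq_mul, map_mul, smul_add, mul_smul_comm, smul_eq_C_mul]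

theorem IsExpRiordanArray.isBranchedSFraction {ν b : F} {R : Matrix ℕ ℕ F}
    (hR : IsExpRiordanArray R (zSeries ν 0 (∏ i : Fin m, (1 + C (x i) * X)))
      (aSeries 1 b 0 (∏ i : Fin m, (1 + C (x i) * X))))
    (hα₀ : ∀ q : ℕ, α (m + q * (m + 1)) = ν + (q : F) * b)
    (hα : ∀ (q : ℕ) (i : Fin m), α (m + q * (m + 1) + ((i : ℕ) + 1)) = ((q : F) + 1) * x i) :
    IsBranchedSFraction m α (mk fun n => R n 0) := by
  obtain ⟨g, f, hgf, rfl⟩ := hR.exists_isRiordanPair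
  set φ : Polynomial F := ∏ i : Fin m, (1 + Polynomial.C (x i) * Polynomial.X) with hφ
  have hφcoe : ∏ i : Fin m, (1 + C (x i) * X) = (φ : PowerSeries F) := by
    rw [hφ, ← Polynomial.coeToPowerSeries.ringHom_apply, map_prod]
    simp
  have hpair : IsRiordanPair g f (Polynomial.C ν * φ : Polynomial F)
      ((1 + Polynomial.C b * Polynomial.X) * φ : Polynomial F) := by
    simpa [zSeries, aSeries, hφcoe] using hgf
  have hcolumns : branchedColumns m α = riordanColumns g f :=
    eq_of_eq_C_add_X_mul (branchedColumns_eq hα₀ hα hφ) hpair.riordanColumns_eq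
  have hcolumn : branchedSProd m α 1 = mk fun n => expRiordan g f n 0 := by
    have h₀ := congrFun hcolumns (Polynomial.X ^ 0)
    rw [branchedColumns_X_pow] at h₀
    simpa [riordanColumns, expRiordan] using h₀
  intro n
  filter_upwards [eventually_gt_atTop n] with d hd
  rw [coeff_branchedSTrunc m α hd, ← hcolumn, branchedSProd, Finset.prod_range_one]

end Branched

/-! ### Coefficientwise nonnegativity -/

/-- The semiring of polynomials with nonnegative coefficients. -/
def nonnegCoeffsSubsemiring (σ : Type*) : Subsemiring (MvPolynomial σ ℝ) where
  carrier := {p | NonnegCoeffs p}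
  zero_mem' _ := by simp
  one_mem' d := by
    classical
    rw [MvPolynomial.coeff_one]
    split_ifs <;> norm_num
  add_mem' hp hq d := by
    rw [MvPolynomial.coeff_add]
    exact add_nonneg (hp d) (hq d)
  mul_mem' hp hq d := by
    classical
    rw [MvPolynomial.coeff_mul]
    exact Finset.sum_nonneg fun x _ => mul_nonneg (hp _) (hq _)

lemma C_mem_nonnegCoeffsSubsemiring {σ : Type*} {y : ℝ} (hy : 0 ≤ y) :
    MvPolynomial.C y ∈ nonnegCoeffsSubsemiring σ := fun d => by
  classical
  rw [MvPolynomial.coeff_C]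
  split_ifs
  exacts [hy, le_rfl]

lemma exists_mem_natCast_mul_eq_one {𝕜 S : Type*} [Field 𝕜] [LinearOrder 𝕜] [IsStrictOrderedRing 𝕜]
    [CommRing S] (h : 𝕜 →+* S) {P : Subsemiring S} (hP : ∀ y : 𝕜, 0 ≤ y → h y ∈ P) {n : ℕ}
    (hn : n ≠ 0) : ∃ u ∈ P, n * u = 1 := by
  refine ⟨h (n : 𝕜)⁻¹, hP _ (by positivity), ?_⟩
  rw [← map_natCast h, ← map_mul, mul_inv_cancel₀ (Nat.cast_ne_zero.mpr hn), map_one]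

theorem IsExpRiordanArray.minorsIn_nonneg {𝕜 : Type*} [Field 𝕜] [LinearOrder 𝕜]
    [IsStrictOrderedRing 𝕜] {r : ℕ} {φ : PowerSeries 𝕜} {ν ω a b c : 𝕜} {R : Matrix ℕ ℕ 𝕜}
    (hR : IsExpRiordanArray R (zSeries ν ω φ) (aSeries a b c φ))
    (hφ : MinorsIn {y : 𝕜 | 0 ≤ y} r (lowerToeplitz φ))
    (hJ : MinorsIn {y : 𝕜 | 0 ≤ y} r (tridiagJ ν ω a b c)) :
    MinorsIn {y : 𝕜 | 0 ≤ y} r R ∧ MinorsIn {y : 𝕜 | 0 ≤ y} r (hankelMat fun n => R n 0) := by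
  have hmap (p : PowerSeries 𝕜) : p.map (algebraMap 𝕜 𝕜) = p := by
    rw [Algebra.algebraMap_self, PowerSeries.map_id, id]
  obtain ⟨M, hM, h⟩ := IsExpRiordanArray.exists_minorsIn (S := 𝕜) (P := .nonneg 𝕜) (φ := φ)
    (fun n hn => exists_mem_natCast_mul_eq_one (.id 𝕜) (fun y hy => hy) hn)
    (by rwa [hmap, hmap])
  obtain rfl : R = M := by simpa using hM
  exact h r hφ hJ

lemma IsPFr.minorsIn_lowerToeplitz_map_C {σ : Type*} {r : ℕ} {φ : PowerSeries ℝ}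
    (hφ : IsPFr r φ) : MinorsIn (nonnegCoeffsSubsemiring σ : Set (MvPolynomial σ ℝ)) r
      (lowerToeplitz (φ.map MvPolynomial.C)) := by
  rw [← map_lowerToeplitz]
  exact MinorsIn.map hφ MvPolynomial.C fun _ hy => C_mem_nonnegCoeffsSubsemiring hy

theorem mainTheorem4_general
    {S : Type*} [CommRing S] {P : Subsemiring S} (hP : ∀ n : ℕ, n ≠ 0 → ∃ u ∈ P, n * u = 1)
    {K : Type*} [Field K] [Algebra S K]
    {𝕜 : Type*} [Field 𝕜] [LinearOrder 𝕜] [IsStrictOrderedRing 𝕜] {F : Type*} [Field F] :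
    (∀ (φ : PowerSeries S) (ν ω a b c : S) (R : Matrix ℕ ℕ K),
      IsExpRiordanArray R ((zSeries ν ω φ).map (algebraMap S K))
        ((aSeries a b c φ).map (algebraMap S K)) →
      ∃ M : Matrix ℕ ℕ S, R = M.map (algebraMap S K) ∧ ∀ r,
        MinorsIn P r (lowerToeplitz φ) → MinorsIn P r (tridiagJ ν ω a b c) →
        MinorsIn P r M ∧ MinorsIn P r (hankelMat fun n => M n 0)) ∧
    (∀ (φ : PowerSeries 𝕜) (ν ω a b c : 𝕜) (R : Matrix ℕ ℕ 𝕜),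
      IsExpRiordanArray R (zSeries ν ω φ) (aSeries a b c φ) →
      0 ≤ ω → 0 ≤ a → 0 ≤ c → ω ≤ ν → a + c ≤ b →
      ∀ r, MinorsIn {y : 𝕜 | 0 ≤ y} r (lowerToeplitz φ) →
        MinorsIn {y : 𝕜 | 0 ≤ y} r R ∧
        MinorsIn {y : 𝕜 | 0 ≤ y} r (hankelMat fun n => R n 0)) ∧
    (∀ (φ : PowerSeries 𝕜) (ν ω a b c : 𝕜) (R : Matrix ℕ ℕ 𝕜),
      IsExpRiordanArray R (zSeries ν ω φ) (aSeries a b c φ) →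
      0 ≤ ω → 0 ≤ a → 0 ≤ c → a ≤ ν → max (a + c) (a + ω) ≤ b →
      ∀ r, MinorsIn {y : 𝕜 | 0 ≤ y} r (lowerToeplitz φ) →
        MinorsIn {y : 𝕜 | 0 ≤ y} r R ∧
        MinorsIn {y : 𝕜 | 0 ≤ y} r (hankelMat fun n => R n 0)) ∧
    (∀ (φ : PowerSeries S) (ν a b : S) (R : Matrix ℕ ℕ K),
      ν ∈ P → a ∈ P → b ∈ P →
      IsExpRiordanArray R ((zSeries ν 0 φ).map (algebraMap S K))
        ((aSeries a b 0 φ).map (algebraMap S K)) →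
      ∃ M : Matrix ℕ ℕ S, R = M.map (algebraMap S K) ∧ ∀ r,
        MinorsIn P r (lowerToeplitz φ) →
        MinorsIn P r M ∧ MinorsIn P r (hankelMat fun n => M n 0)) ∧
    (∀ (m : ℕ) (x : Fin m → F) (ν b : F) (R : Matrix ℕ ℕ F) (α : ℕ → F),
      IsExpRiordanArray R
        (zSeries ν 0 (∏ i : Fin m, (1 + PowerSeries.C (x i) * PowerSeries.X)))
        (aSeries 1 b 0 (∏ i : Fin m, (1 + PowerSeries.C (x i) * PowerSeries.X))) →
      (∀ q : ℕ, α (m + q * (m + 1)) = ν + (q : F) * b) →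
      (∀ (q : ℕ) (i : Fin m),
        α (m + q * (m + 1) + ((i : ℕ) + 1)) = ((q : F) + 1) * x i) →
      IsBranchedSFraction m α (PowerSeries.mk fun n => R n 0)) := by
  refine ⟨fun φ ν ω a b c R hR => hR.exists_minorsIn hP, ?_, ?_, ?_, ?_⟩
  · intro φ ν ω a b c R hR hω ha hc hων hb r hφ
    exact hR.minorsIn_nonneg hφ (minorsIn_tridiagJ_of_columnDominant hω ha hc hων hb r)
  · intro φ ν ω a b c R hR hω ha hc haν hb r hφ
    exact hR.minorsIn_nonneg hφ (minorsIn_tridiagJ_of_rowDominant hω ha hc haν hb r)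
  · intro φ ν a b R hν ha hb hR
    obtain ⟨M, hM, hTP⟩ := hR.exists_minorsIn hP
    exact ⟨M, hM, fun r hφ => hTP r hφ (minorsIn_tridiagJ_zero_zero hν ha hb r)⟩
  · exact fun m x ν b R α hR hα₀ hα => hR.isBranchedSFraction hα₀ hα

theorem mainTheorem4
    {σ : Type*} {K : Type*} [Field K] [Algebra (MvPolynomial σ ℝ) K]
    [IsFractionRing (MvPolynomial σ ℝ) K]
    {F : Type*} [Field F] [CharZero F] :
    -- (i)
    (∀ (r : ℕ) (φ : PowerSeries ℝ) (ν ω a b c : MvPolynomial σ ℝ) (R : Matrix ℕ ℕ K),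
      IsPFr r φ →
      IsExpRiordanArray R
        ((zSeries ν ω (φ.map MvPolynomial.C)).map (algebraMap (MvPolynomial σ ℝ) K))
        ((aSeries a b c (φ.map MvPolynomial.C)).map (algebraMap (MvPolynomial σ ℝ) K)) →
      IsCoeffTPr r (tridiagJ ν ω a b c) →
      ∃ M : Matrix ℕ ℕ (MvPolynomial σ ℝ),
        R = M.map (algebraMap (MvPolynomial σ ℝ) K) ∧
        IsCoeffTPr r M ∧ IsCoeffTPr r (hankelMat fun n => M n 0)) ∧
    -- (ii)
    (∀ (φ : PowerSeries ℝ) (ν ω a b c : ℝ) (R : Matrix ℕ ℕ ℝ),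
      IsExpRiordanArray R (zSeries ν ω φ) (aSeries a b c φ) →
      0 ≤ ν → 0 ≤ ω → 0 ≤ a → 0 ≤ b → 0 ≤ c → ω ≤ ν → a + c ≤ b →
      (∀ r, IsPFr r φ → IsTPr r R ∧ IsTPr r (hankelMat fun n => R n 0)) ∧
      (IsPF φ → IsTP R ∧ IsTP (hankelMat fun n => R n 0))) ∧
    -- (iii)
    (∀ (φ : PowerSeries ℝ) (ν ω a b c : ℝ) (R : Matrix ℕ ℕ ℝ),
      IsExpRiordanArray R (zSeries ν ω φ) (aSeries a b c φ) →
      0 ≤ ν → 0 ≤ ω → 0 ≤ a → 0 ≤ b → 0 ≤ c → a ≤ ν → max (a + c) (a + ω) ≤ b →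
      (∀ r, IsPFr r φ → IsTPr r R ∧ IsTPr r (hankelMat fun n => R n 0)) ∧
      (IsPF φ → IsTP R ∧ IsTP (hankelMat fun n => R n 0))) ∧
    -- (iv), with `a`, `b`, `ν` the indeterminates or, more generally, any polynomials
    -- with nonnegative coefficients
    (∀ (φ : PowerSeries ℝ) (ν a b : MvPolynomial σ ℝ) (R : Matrix ℕ ℕ K),
      IsPF φ →
      NonnegCoeffs ν → NonnegCoeffs a → NonnegCoeffs b →
      IsExpRiordanArray R
        ((zSeries ν 0 (φ.map MvPolynomial.C)).map (algebraMap (MvPolynomial σ ℝ) K))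
        ((aSeries a b 0 (φ.map MvPolynomial.C)).map (algebraMap (MvPolynomial σ ℝ) K)) →
      ∃ M : Matrix ℕ ℕ (MvPolynomial σ ℝ),
        R = M.map (algebraMap (MvPolynomial σ ℝ) K) ∧
        IsCoeffTP M ∧ IsCoeffTP (hankelMat fun n => M n 0)) ∧
    -- (v)
    (∀ (m : ℕ) (x : Fin m → F) (ν b : F) (R : Matrix ℕ ℕ F) (α : ℕ → F),
      IsExpRiordanArray R
        (zSeries ν 0 (∏ i : Fin m, (1 + PowerSeries.C (x i) * PowerSeries.X)))
        (aSeries 1 b 0 (∏ i : Fin m, (1 + PowerSeries.C (x i) * PowerSeries.X))) →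
      (∀ q : ℕ, α (m + q * (m + 1)) = ν + (q : F) * b) →
      (∀ (q : ℕ) (i : Fin m),
        α (m + q * (m + 1) + ((i : ℕ) + 1)) = ((q : F) + 1) * x i) →
      IsBranchedSFraction m α (PowerSeries.mk fun n => R n 0)) := by
  have hP (n : ℕ) (hn : n ≠ 0) : ∃ u ∈ nonnegCoeffsSubsemiring σ, n * u = 1 :=
    exists_mem_natCast_mul_eq_one MvPolynomial.C (fun _ => C_mem_nonnegCoeffsSubsemiring) hn
  obtain ⟨hi, hii, hiii, hiv, hv⟩ := mainTheorem4_general hP (K := K) (𝕜 := ℝ) (F := F)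
  refine ⟨fun r φ ν ω a b c R hφ hR hJ => ?_, ?_, ?_, ?_, hv⟩
  · obtain ⟨M, hM, h⟩ := hi _ ν ω a b c R hR
    exact ⟨M, hM, h r hφ.minorsIn_lowerToeplitz_map_C hJ⟩
  · intro φ ν ω a b c R hR _ hω ha _ hc hων hb
    have h := hii φ ν ω a b c R hR hω ha hc hων hb
    exact ⟨h, fun hφ => forall_and.mp fun r => h r (hφ r)⟩
  · intro φ ν ω a b c R hR _ hω ha _ hc haν hb
    have h := hiii φ ν ω a b c R hR hω ha hc haν hb
    exact ⟨h, fun hφ => forall_and.mp fun r => h r (hφ r)⟩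
  · intro φ ν a b R hφ hν ha hb hR
    obtain ⟨M, hM, h⟩ := hiv _ ν a b R hν ha hb hR
    exact ⟨M, hM, forall_and.mp fun r =>
      h r (IsPFr.minorsIn_lowerToeplitz_map_C (hφ r))⟩
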